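/- Let $1\le p<\infty$ and let $(\Omega_1,\mu_1)$, $(\Omega_2,\mu_2)$ be finite measure spaces. Let $X=X(\mu_1)$ be a Banach function space over $\mu_1$: a linear subspace of $L^0(\mu_1)$ (real measurable functions modulo $\mu_1$-a.e. equality) that contains the simple functions and is complete for a norm such that $|f|\le|g|$ with $g\in X$ implies $f\in X$ and $\|f\|_X\le\|g\|_X$. Let $B_{X^*}$ be the closed unit ball of the dual of $X$ with the weak$^*$ topology. Let $V\subset L^1(\mu_2)_+$ be relatively weakly compact, and let $m_V$ be the countably additive vector measure $$m_V(A)=\Big(\int_A v\,d\mu_2\Big)_{v\in V}\in\ell^\infty(V).$$ For a vector measure $m$ with values in a Banach space $F$, $L^1(m)$ is the space of measurable $f$ that are integrable with respect to each scalar measure $\langle m,\varphi\rangle$, $\varphi\in F^*$, and for which for each measurable $A$ there is $\int_A f\,dm\in F$ with $\langle\int_A f\,dm,\varphi\rangle=\int_A f\,d\langle m,\varphi\rangle$ for all $\varphi\in F^*$; its norm is $\|f\|_{L^1(m)}=\sup_{\varphi\in B_{F^*}}\int|f|\,d|\langle m,\varphi\rangle|$. Moreover $L^p(m)=\{f \text{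 measurable}: |f|^p\in L^1(m)\}$ with $\|f\|_{L^p(m)}=\||f|^p\|_{L^1(m)}^{1/p}$. Let $T:X\to L^0(\mu_2)$ be a linear operator with $Tx\in L^p(v\,d\mu_2)$ for all $x\in X$ and $v\in V$. Consider the statements: (i) $T$ is a lattice $p$-summing operator from $X$ to $L^p(m_V)$; that is, $Tx\in L^p(m_V)$ for all $x\in X$ and there is $C>0$ such that for all $x_1,\dots,x_n\in X$ $$\Big\|\Big(\sum_{i=1}^n|Tx_i|^p\Big)^{1/p}\Big\|_{L^p(m_V)}\le C\sup_{x^*\in B_{X^*}}\Big(\sum_{i=1}^n|\langle x_i,x^*\rangle|^p\Big)^{1/p}.$$ (ii) There is $C>0$ such that for every $v\in V$ there is a regular Borel probability measure $\eta$ on $B_{X^*}$ with $$\Big(\int_{\Omega_2}|Tx|^p\,v\,d\mu_2\Big)^{1/p}\le C\Big(\int_{B_{X^*}}|\langle x,\cdot\rangle|^p\,d\eta\Big)^{1/p},\qquad x\in X.$$ (iii) The operators $T:X\to L^p(v\,d\mu_2)$, $v\in V$, factor uniformly through subspaces $S=\{\langle x,\cdot\rangle:x\in X\}\subset L^p(\eta)$: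 there is $C$ such that for every $v\in V$ there are a regular Borel probability measure $\eta$ on $B_{X^*}$ and a bounded linear map $T_0:S\to L^p(v\,d\mu_2)$, where $S=\{\langle x,\cdot\rangle:x\in X\}$ carries the norm of $L^p(\eta)$, with $\|T_0\|\le C$ and $Tx=T_0\langle x,\cdot\rangle$ in $L^p(v\,d\mu_2)$ for all $x\in X$. Then (ii) and (iii) are equivalent. If $T$ takes its values in $L^p(m_V)$, so that it is well defined as an operator $T:X\to L^p(m_V)$, then (i), (ii) and (iii) are equivalent. (Since (i) includes that $T$ takes its values in $L^p(m_V)$, it always implies (ii) and (iii).) -/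

import Mathlib

open MeasureTheory Filter Topology
open scoped ENNReal

/-! ### Banach function spaces over a measure space -/

/-- A linear subspace of `L⁰(μ)` (measurable real functions modulo equality `μ`-a.e.) that contains
all simple functions, with a norm on it for which it is a normed ideal: if `|f| ≤ |g|` and `g`
belongs to the space, then so does `f`, and `‖f‖ ≤ ‖g‖`. -/
structure NormedFunctionSpace {Ω : Type*} [MeasurableSpace Ω] (μ : Measure Ω) where
  carrier : Submodule ℝ (Ω →ₘ[μ] ℝ)
  norm : AddGroupNorm carrier
  norm_smul : ∀ (c : ℝ) (f : carrier), norm (c • f) = |c| * norm f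
  simpleFunc_mem : ∀ s : SimpleFunc Ω ℝ, AEEqFun.mk s s.aestronglyMeasurable ∈ carrier
  solid : ∀ f g : Ω →ₘ[μ] ℝ, |f| ≤ |g| → g ∈ carrier → f ∈ carrier
  norm_mono : ∀ f g : carrier, |(f : Ω →ₘ[μ] ℝ)| ≤ |(g : Ω →ₘ[μ] ℝ)| → norm f ≤ norm g

noncomputable instance {Ω : Type*} [MeasurableSpace Ω] {μ : Measure Ω}
    (X : NormedFunctionSpace μ) : NormedAddCommGroup X.carrier :=
  X.norm.toNormedAddCommGroup

noncomputable instance {Ω : Type*} [MeasurableSpace Ω] {μ : Measure Ω}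
    (X : NormedFunctionSpace μ) : NormedSpace ℝ X.carrier where
  norm_smul_le c f := (X.norm_smul c f).le

/-- Completeness of the space for its norm. -/
def NormedFunctionSpace.IsComplete {Ω : Type*} [MeasurableSpace Ω] {μ : Measure Ω}
    (X : NormedFunctionSpace μ) : Prop := CompleteSpace X.carrier

/-- A Banach function space `X(μ)`: a normed ideal of `L⁰(μ)` containing the simple functions that
is complete for its norm. -/
structure BanachFunctionSpace {Ω : Type*} [MeasurableSpace Ω] (μ : Measure Ω) extends
    NormedFunctionSpace μ where
  complete : toNormedFunctionSpace.IsComplete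

/-! ### The dual ball with its weak-star topology -/

/-- The closed unit ball `B_{E*}` of the dual of `E`, with the weak-star topology. -/
abbrev DualBall (E : Type*) [NormedAddCommGroup E] [NormedSpace ℝ E] : Type _ :=
  (WeakDual.toStrongDual ⁻¹' Metric.closedBall (0 : StrongDual ℝ E) 1 : Set (WeakDual ℝ E))

instance DualBall.instCompactSpace (E : Type*) [NormedAddCommGroup E] [NormedSpace ℝ E] :
    CompactSpace (DualBall E) :=
  isCompact_iff_compactSpace.mp (WeakDual.isCompact_closedBall (0 : StrongDual ℝ E) 1)

/-- The dual ball carries the Borel `σ`-algebra of the weak-star topology. -/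
noncomputable instance DualBall.instMeasurableSpace (E : Type*) [NormedAddCommGroup E] [NormedSpace ℝ E] :
    MeasurableSpace (DualBall E) := borel _

instance DualBall.instBorelSpace (E : Type*) [NormedAddCommGroup E] [NormedSpace ℝ E] :
    BorelSpace (DualBall E) := ⟨rfl⟩

/-- The canonical map `E → C(B_{E*})`, `x ↦ ⟨x, ·⟩`. -/
noncomputable def evalC (E : Type*) [NormedAddCommGroup E] [NormedSpace ℝ E] :
    E →ₗ[ℝ] C(DualBall E, ℝ) where
  toFun x := ⟨fun φ => (φ : WeakDual ℝ E) x,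
    (WeakDual.eval_continuous x).comp continuous_subtype_val⟩
  map_add' x y := by ext φ; exact map_add (φ : WeakDual ℝ E) x y
  map_smul' c x := by ext φ; exact map_smul (φ : WeakDual ℝ E) c x

/-- The map `E → L^p(η)`, `x ↦ ⟨x, ·⟩`, for a finite Borel measure `η` on `B_{E*}`. -/
noncomputable def evalLp (E : Type*) [NormedAddCommGroup E] [NormedSpace ℝ E]
    (p : ℝ≥0∞) [Fact (1 ≤ p)] (η : Measure (DualBall E)) [IsFiniteMeasure η] :
    E →ₗ[ℝ] Lp ℝ p η :=
  (ContinuousMap.toLp p η ℝ : C(DualBall E, ℝ) →L[ℝ] Lp ℝ p η).toLinearMap ∘ₗ evalC E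

/-- The subspace `S = {⟨x, ·⟩ : x ∈ E}` of `L^p(η)`. -/
noncomputable abbrev evalSubspace (E : Type*) [NormedAddCommGroup E] [NormedSpace ℝ E]
    (p : ℝ≥0∞) [Fact (1 ≤ p)] (η : Measure (DualBall E)) [IsFiniteMeasure η] :
    Submodule ℝ (Lp ℝ p η) :=
  LinearMap.range (evalLp E p η)

/-! ### Integrable functions with respect to a vector measure -/

section VectorMeasureSpaces

variable {Ω F : Type*} [MeasurableSpace Ω] [NormedAddCommGroup F] [NormedSpace ℝ F]

/-- The scalar measure `⟨m, φ⟩ : A ↦ ⟨m(A), φ⟩`. -/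
noncomputable def scalarMeasure (m : VectorMeasure Ω F) (φ : StrongDual ℝ F) : SignedMeasure Ω :=
  m.mapRange (φ : F →+ ℝ) φ.continuous

/-- Membership in `L¹(m)`: the measurable function `f` is integrable with respect to every scalar
measure `⟨m, φ⟩`, and over each measurable set `A` it has an integral `∫_A f dm ∈ F`. -/
def MemL1Vec (m : VectorMeasure Ω F) (f : Ω → ℝ) : Prop :=
  Measurable f ∧
  (∀ φ : StrongDual ℝ F, (scalarMeasure m φ).Integrable f) ∧
  ∀ A : Set Ω, MeasurableSet A →
    ∃ e : F, ∀ φ : StrongDual ℝ F, φ e = ∫ᵛ ω in A, f ω ∂•(scalarMeasure m φ)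

/-- The norm of `L¹(m)`: the supremum over `φ ∈ B_{F*}` of `∫ |f| d|⟨m, φ⟩|`. -/
noncomputable def normL1Vec (m : VectorMeasure Ω F) (f : Ω → ℝ) : ℝ≥0∞ :=
  ⨆ φ ∈ {φ : StrongDual ℝ F | ‖φ‖ ≤ 1}, ∫⁻ ω, ‖f ω‖ₑ ∂(scalarMeasure m φ).variation

/-- Membership in `L^p(m)`, `1 ≤ p < ∞`: `f` is measurable and `|f|^p ∈ L¹(m)`. -/
def MemLpVec (m : VectorMeasure Ω F) (p : ℝ≥0∞) (f : Ω → ℝ) : Prop :=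
  Measurable f ∧ MemL1Vec m (fun ω => |f ω| ^ p.toReal)

/-- The norm of `L^p(m)`: `‖f‖ = ‖|f|^p‖_{L¹(m)}^{1/p}`. -/
noncomputable def normLpVec (m : VectorMeasure Ω F) (p : ℝ≥0∞) (f : Ω → ℝ) : ℝ≥0∞ :=
  normL1Vec m (fun ω => |f ω| ^ p.toReal) ^ (1 / p.toReal)

/-- A linear map `T` from a normed space `E` into the measurable functions is a lattice `p`-summing
operator `T : E → L^p(m)`: it takes its values in `L^p(m)`, and for some constant `C`
`‖(∑ |T xᵢ|^p)^{1/p}‖_{L^p(m)} ≤ C sup_{φ ∈ B_{E*}} (∑ |⟨xᵢ, φ⟩|^p)^{1/p}`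
for every finite family `x₁, …, xₙ` in `E`. -/
def IsLatticeSumming {E : Type*} [NormedAddCommGroup E] [NormedSpace ℝ E] {μ : Measure Ω}
    (m : VectorMeasure Ω F) (p : ℝ≥0∞) (T : E →ₗ[ℝ] (Ω →ₘ[μ] ℝ)) : Prop :=
  (∀ x, MemLpVec m p (T x)) ∧
  ∃ C : ℝ, 0 < C ∧ ∀ (n : ℕ) (x : Fin n → E),
    normLpVec m p (fun ω => (∑ i, |T (x i) ω| ^ p.toReal) ^ (1 / p.toReal)) ≤
      ENNReal.ofReal (C * ⨆ φ : DualBall E,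
        (∑ i, |(φ : WeakDual ℝ E) (x i)| ^ p.toReal) ^ (1 / p.toReal))

end VectorMeasureSpaces

/-! ### Weights -/

section Weights

variable {Ω : Type*} [MeasurableSpace Ω] {μ : Measure Ω}

/-- The weighted measure `v dμ`. -/
noncomputable def weighted (μ : Measure Ω) (v : Lp ℝ 1 μ) : Measure Ω :=
  μ.withDensity (fun ω => ENNReal.ofReal (v ω))

/-- `V ⊆ L¹(μ)₊` is relatively weakly compact: its elements are nonnegative and its closure for the
weak topology of `L¹(μ)` is weakly compact. -/
structure IsWeightFamily (V : Set (Lp ℝ 1 μ)) : Prop where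
  nonneg : ∀ v ∈ V, 0 ≤ v
  compact : IsCompact (closure (toWeakSpace ℝ (Lp ℝ 1 μ) '' V))

/-- The functional `v ↦ ∫_A v dμ` is weakly continuous. -/
theorem continuous_weak_setIntegral (A : Set Ω) :
    Continuous fun v : WeakSpace ℝ (Lp ℝ 1 μ) =>
      ∫ ω in A, ((toWeakSpace ℝ (Lp ℝ 1 μ)).symm v) ω ∂μ := by
  let L : StrongDual ℝ (Lp ℝ 1 μ) := LinearMap.mkContinuous
    { toFun := fun v => ∫ ω in A, v ω ∂μ
      map_add' := fun v w => by
        rw [← integral_add (L1.integrable_coeFn v).integrableOn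
          (L1.integrable_coeFn w).integrableOn]
        exact integral_congr_ae (ae_restrict_of_ae (Lp.coeFn_add v w))
      map_smul' := fun c v => by
        rw [RingHom.id_apply, ← integral_smul]
        exact integral_congr_ae (ae_restrict_of_ae (Lp.coeFn_smul c v)) } 1 (fun v => by
      simp only [LinearMap.coe_mk, AddHom.coe_mk, one_mul]
      refine (norm_integral_le_integral_norm _).trans ?_
      rw [L1.norm_eq_integral_norm]
      exact setIntegral_le_integral (L1.integrable_coeFn v).norm
        (Eventually.of_forall fun _ => norm_nonneg _))
  exact WeakBilin.eval_continuous (topDualPairing ℝ (Lp ℝ 1 μ)).flip L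

theorem IsWeightFamily.setIntegral_nonneg {V : Set (Lp ℝ 1 μ)} (hV : IsWeightFamily V)
    (A : Set Ω) {v : WeakSpace ℝ (Lp ℝ 1 μ)}
    (hv : v ∈ closure (toWeakSpace ℝ (Lp ℝ 1 μ) '' V)) :
    0 ≤ ∫ ω in A, ((toWeakSpace ℝ (Lp ℝ 1 μ)).symm v) ω ∂μ := by
  have hcl : IsClosed {v : WeakSpace ℝ (Lp ℝ 1 μ) |
      0 ≤ ∫ ω in A, ((toWeakSpace ℝ (Lp ℝ 1 μ)).symm v) ω ∂μ} :=
    IsClosed.preimage (continuous_weak_setIntegral (μ := μ) A) isClosed_Ici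
  refine closure_minimal ?_ hcl hv
  rintro _ ⟨w, hw, rfl⟩
  have h0 : 0 ≤ᵐ[μ] (w : Ω → ℝ) := (Lp.coeFn_nonneg w).2 (hV.nonneg w hw)
  have h1 : 0 ≤ ∫ ω in A, w ω ∂μ := integral_nonneg_of_ae (ae_restrict_of_ae h0)
  simpa using h1

open Classical in
/-- The family `(∫_A v dμ)_{v ∈ V}` (and zero for non-measurable `A`). -/
noncomputable def weightFamily (V : Set (Lp ℝ 1 μ)) (A : Set Ω) (v : V) : ℝ :=
  if MeasurableSet A then ∫ ω in A, (v : Lp ℝ 1 μ) ω ∂μ else 0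

theorem IsWeightFamily.memℓp {V : Set (Lp ℝ 1 μ)} (hV : IsWeightFamily V) (A : Set Ω) :
    Memℓp (weightFamily V A) ∞ := by
  by_cases hA : MeasurableSet A
  · obtain ⟨C, hC⟩ := hV.compact.exists_bound_of_continuousOn
      (continuous_weak_setIntegral (μ := μ) A).continuousOn
    refine memℓp_infty ⟨C, ?_⟩
    rintro _ ⟨v, rfl⟩
    have := hC _ (subset_closure ⟨v, v.2, rfl⟩)
    simpa [weightFamily, hA] using this
  · have : weightFamily V A = 0 := by ext v; simp [weightFamily, hA]
    rw [this]; exact zero_memℓp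

/-- The vector measure `m_V : Σ → ℓ^∞(V)`, `m_V(A) = (∫_A v dμ)_{v ∈ V}`, of a relatively weakly
compact family `V ⊆ L¹(μ)₊`. -/
noncomputable def weightMeasure (V : Set (Lp ℝ 1 μ)) (hV : IsWeightFamily V) :
    VectorMeasure Ω (lp (fun _ : V => ℝ) ∞) where
  measureOf' A := ⟨weightFamily V A, hV.memℓp A⟩
  empty' := by ext v; simp [weightFamily]
  not_measurable' A hA := by ext v; simp [weightFamily, hA]
  m_iUnion' A hA hdisj := by
    have key : TendstoUniformlyOn
        (fun (s : Finset ℕ) (v : WeakSpace ℝ (Lp ℝ 1 μ)) =>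
          ∑ i ∈ s, ∫ ω in A i, ((toWeakSpace ℝ (Lp ℝ 1 μ)).symm v) ω ∂μ)
        (fun v => ∫ ω in ⋃ i, A i, ((toWeakSpace ℝ (Lp ℝ 1 μ)).symm v) ω ∂μ) atTop
        (closure (toWeakSpace ℝ (Lp ℝ 1 μ) '' V)) := by
      refine Monotone.tendstoUniformlyOn_of_forall_tendsto hV.compact (fun s => ?_)
        (fun v hv s t hst => ?_) (continuous_weak_setIntegral _).continuousOn (fun v _ => ?_)
      · exact (continuous_finsetSum _ fun i _ => continuous_weak_setIntegral (A i)).continuousOn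
      · exact Finset.sum_le_sum_of_subset_of_nonneg hst
          fun i _ _ => hV.setIntegral_nonneg (A i) hv
      · exact hasSum_integral_iUnion hA hdisj (L1.integrable_coeFn _).integrableOn
    rw [HasSum, SummationFilter.unconditional_filter, Metric.tendsto_atTop]
    intro ε hε
    obtain ⟨N, hN⟩ := eventually_atTop.1 (Metric.tendstoUniformlyOn_iff.1 key (ε / 2) (half_pos hε))
    refine ⟨N, fun s hs => ?_⟩
    rw [dist_eq_norm]
    refine (lp.norm_le_of_forall_le (half_pos hε).le fun v => ?_).trans_lt (half_lt_self hε)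
    have := hN s hs _ (subset_closure ⟨v, v.2, rfl⟩)
    rw [dist_comm, Real.dist_eq] at this
    rw [lp.coeFn_sub, Pi.sub_apply, lp.coeFn_sum, Finset.sum_apply, Real.norm_eq_abs]
    simpa [weightFamily, hA, MeasurableSet.iUnion hA] using this.le

end Weights

/-! ### Domination and factorization -/

section Conditions

variable {Ω₁ Ω₂ : Type*} [MeasurableSpace Ω₁] [MeasurableSpace Ω₂]
  {μ₁ : Measure Ω₁} {μ₂ : Measure Ω₂}

/-- Uniform average domination: there is `C > 0` such that for each `v ∈ V` there is a regular Borel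
probability measure `η` on the dual ball with
`(∫ |T x|^p v dμ₂)^{1/p} ≤ C (∫ |⟨x, ·⟩|^p dη)^{1/p}` for all `x`. -/
def IsAverageDominated (X : BanachFunctionSpace μ₁) (V : Set (Lp ℝ 1 μ₂)) (p : ℝ≥0∞)
    (T : X.carrier →ₗ[ℝ] (Ω₂ →ₘ[μ₂] ℝ)) : Prop :=
  ∃ C : ℝ, 0 < C ∧ ∀ v ∈ V, ∃ η : Measure (DualBall X.carrier),
    IsProbabilityMeasure η ∧ η.Regular ∧ ∀ x : X.carrier,
      (∫ ω, |T x ω| ^ p.toReal * (v : Ω₂ → ℝ) ω ∂μ₂) ^ (1 / p.toReal) ≤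
        C * (∫ φ : DualBall X.carrier,
          |(φ : WeakDual ℝ X.carrier) x| ^ p.toReal ∂η) ^ (1 / p.toReal)

/-- Uniform factorization through `S = {⟨x, ·⟩}`: there is `C` such that for each `v ∈ V` there are a
regular Borel probability measure `η` on the dual ball and a bounded linear map
`T₀ : S → L^p(v dμ₂)` on `S ⊆ L^p(η)`, of norm at most `C`, with `T x = T₀ ⟨x, ·⟩` for all `x`. -/
def FactorsUniformly (X : BanachFunctionSpace μ₁) (V : Set (Lp ℝ 1 μ₂)) (p : ℝ≥0∞)
    [Fact (1 ≤ p)] (T : X.carrier →ₗ[ℝ] (Ω₂ →ₘ[μ₂] ℝ)) : Prop :=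
  ∃ C : ℝ, ∀ v ∈ V, ∃ (η : Measure (DualBall X.carrier)) (_ : IsProbabilityMeasure η),
    η.Regular ∧ ∃ T₀ : evalSubspace X.carrier p η →L[ℝ] Lp ℝ p (weighted μ₂ v),
      ‖T₀‖ ≤ C ∧ ∀ x : X.carrier,
        T₀ ⟨evalLp X.carrier p η x, LinearMap.mem_range_self _ x⟩ =ᵐ[weighted μ₂ v] T x

end Conditions

/-! The link between (i) and (ii) is that the norm of `L¹(m_V)` needs only the coordinate
functionals: it equals `sup_v ∫ |f| v dμ₂` (`normL1Vec_weightMeasure`). Hence (i) says that, with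
one constant `C`, each `T : X → L^p(v dμ₂)` satisfies the `p`-summing inequality on finite families.
For fixed `v` this is the hypothesis of Pietsch domination (`exists_probability_dominating`):
Hahn–Banach separates the convex hull of the functions `|⟨x,·⟩|^p - C^{-p} ∫ |Tx|^p v dμ₂` from the
negative functions on the weak-star compact dual ball, and Riesz representation turns the functional
into `η`. Conversely, summing the domination over a family and bounding the integrand by its maximum
returns (i), with the same `C`. Finally, domination says exactly that `⟨x,·⟩ ↦ Tx` is well defined
and bounded by `C`, which is (iii). -/

/-! ### The norm of `L¹(m_V)` -/

theorem SignedMeasure.exists_variation_apply_eq {Ω : Type*} [MeasurableSpace Ω]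
    (s : SignedMeasure Ω) : ∃ P : Set Ω, MeasurableSet P ∧ ∀ A, MeasurableSet A →
      0 ≤ s (P ∩ A) - s (Pᶜ ∩ A) ∧
        s.variation A = ENNReal.ofReal (s (P ∩ A) - s (Pᶜ ∩ A)) := by
  obtain ⟨P, hP, h0, h1, hpos, hneg⟩ := s.toJordanDecomposition_spec
  refine ⟨P, hP, fun A hA => ?_⟩
  have hreal : s.totalVariation.real A = s (P ∩ A) - s (Pᶜ ∩ A) := by
    rw [SignedMeasure.totalVariation, measureReal_add_apply, hpos, hneg,
      SignedMeasure.toMeasureOfZeroLE_real_apply _ h0 hP hA,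
      SignedMeasure.toMeasureOfLEZero_real_apply _ h1 hP.compl hA, sub_eq_add_neg]
  rw [← hreal, ← SignedMeasure.totalVariation_eq_variation, ofReal_measureReal]
  exact ⟨measureReal_nonneg, rfl⟩

section

variable {Ω : Type*} [MeasurableSpace Ω] {μ : Measure Ω}

instance isFiniteMeasure_weighted (v : Lp ℝ 1 μ) : IsFiniteMeasure (weighted μ v) :=
  isFiniteMeasure_withDensity_ofReal (L1.integrable_coeFn v).2

theorem weighted_absolutelyContinuous (v : Lp ℝ 1 μ) : weighted μ v ≪ μ :=
  withDensity_absolutelyContinuous _ _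

theorem weighted_real_apply {v : Lp ℝ 1 μ} (hv : 0 ≤ v) {A : Set Ω} (hA : MeasurableSet A) :
    (weighted μ v).real A = ∫ ω in A, v ω ∂μ := by
  have h0 : 0 ≤ᵐ[μ] (v : Ω → ℝ) := (Lp.coeFn_nonneg v).2 hv
  rw [measureReal_def, weighted, withDensity_apply _ hA,
    integral_eq_lintegral_of_nonneg_ae (ae_restrict_of_ae h0)
      (L1.integrable_coeFn v).1.restrict]

theorem weightMeasure_apply {V : Set (Lp ℝ 1 μ)} (hV : IsWeightFamily V) {A : Set Ω}
    (hA : MeasurableSet A) (v : V) :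
    weightMeasure V hV A v = (weighted μ v).real A := by
  rw [weighted_real_apply (hV.nonneg v v.2) hA]
  change weightFamily V A v = _
  simp [weightFamily, hA]

theorem scalarMeasure_eval {V : Set (Lp ℝ 1 μ)} (hV : IsWeightFamily V) (v : V) :
    scalarMeasure (weightMeasure V hV) (lp.evalCLM ℝ (fun _ : V => ℝ) ∞ v) =
      (weighted μ v).toSignedMeasure := by
  ext A hA
  rw [Measure.toSignedMeasure_apply_measurable hA, ← weightMeasure_apply hV hA v]
  rfl

/-- A Hahn set `P` of `⟨m_V, φ⟩` writes the left side as `φ e` for one vector `e` of `ℓ^∞(V)`. Since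
the weights are nonnegative, the signs introduced by `P` only decrease the coordinates of `e`, so
`‖e‖` is at most the right side. -/
theorem simpleFunc_lintegral_variation_le {V : Set (Lp ℝ 1 μ)} (hV : IsWeightFamily V)
    (φ : StrongDual ℝ (lp (fun _ : V => ℝ) ∞)) (hφ : ‖φ‖ ≤ 1) (g : SimpleFunc Ω NNReal) :
    (g.map ((↑) : NNReal → ℝ≥0∞)).lintegral (scalarMeasure (weightMeasure V hV) φ).variation ≤
      ⨆ v : V, (g.map ((↑) : NNReal → ℝ≥0∞)).lintegral (weighted μ v) := by
  set m := weightMeasure V hV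
  set M := ⨆ v : V, (g.map ((↑) : NNReal → ℝ≥0∞)).lintegral (weighted μ v)
  by_cases hMt : M = ∞
  · rw [hMt]; exact le_top
  obtain ⟨P, hP, hvar⟩ := SignedMeasure.exists_variation_apply_eq (scalarMeasure m φ)
  set A : NNReal → Set Ω := fun x => g ⁻¹' {x} with hA
  have hAm : ∀ x, MeasurableSet (A x) := fun x => g.measurableSet_preimage _
  set e : lp (fun _ : V => ℝ) ∞ := ∑ x ∈ g.range, (x : ℝ) • (m (P ∩ A x) - m (Pᶜ ∩ A x)) with he
  have hsm : ∀ B, scalarMeasure m φ B = φ (m B) := fun B => rfl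
  have hnn : ∀ x, 0 ≤ φ (m (P ∩ A x) - m (Pᶜ ∩ A x)) := fun x => by
    rw [map_sub]
    exact (hvar _ (hAm x)).1
  have hnorm : ‖e‖ ≤ M.toReal := by
    refine lp.norm_le_of_forall_le ENNReal.toReal_nonneg fun v => ?_
    calc ‖e v‖ = ‖∑ x ∈ g.range, (x : ℝ) *
          ((weighted μ v).real (P ∩ A x) - (weighted μ v).real (Pᶜ ∩ A x))‖ := by
          rw [he, lp.coeFn_sum, Finset.sum_apply]
          congr 1
          refine Finset.sum_congr rfl fun x _ => ?_
          rw [lp.coeFn_smul, Pi.smul_apply, lp.coeFn_sub, Pi.sub_apply,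
            weightMeasure_apply hV (hP.inter (hAm x)),
            weightMeasure_apply hV (hP.compl.inter (hAm x)), smul_eq_mul]
      _ ≤ ∑ x ∈ g.range, (x : ℝ) * (weighted μ v).real (A x) := by
          refine (norm_sum_le _ _).trans (Finset.sum_le_sum fun x _ => ?_)
          rw [norm_mul, Real.norm_of_nonneg x.coe_nonneg]
          refine mul_le_mul_of_nonneg_left ?_ x.coe_nonneg
          have h1 : (weighted μ v).real (P ∩ A x) ≤ (weighted μ v).real (A x) :=
            measureReal_mono Set.inter_subset_right
          have h2 : (weighted μ v).real (Pᶜ ∩ A x) ≤ (weighted μ v).real (A x) :=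
            measureReal_mono Set.inter_subset_right
          rw [Real.norm_eq_abs]
          -- Both terms lie between `0` and the measure of `A x`, hence so does the absolute value
          -- of their difference.
          exact abs_sub_le_of_nonneg_of_le measureReal_nonneg h1 measureReal_nonneg h2
      _ = ((g.map ((↑) : NNReal → ℝ≥0∞)).lintegral (weighted μ v)).toReal := by
          rw [SimpleFunc.map_lintegral, ENNReal.toReal_sum]
          · simp [measureReal_def, hA]
          · exact fun x _ => ENNReal.mul_ne_top ENNReal.coe_ne_top (measure_ne_top _ _)
      _ ≤ M.toReal := ENNReal.toReal_mono hMt (le_iSup (fun v : V =>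
          (g.map ((↑) : NNReal → ℝ≥0∞)).lintegral (weighted μ v)) v)
  calc _ = ∑ x ∈ g.range, ENNReal.ofReal ((x : ℝ) * φ (m (P ∩ A x) - m (Pᶜ ∩ A x))) := by
        rw [SimpleFunc.map_lintegral]
        refine Finset.sum_congr rfl fun x _ => ?_
        rw [(hvar _ (hAm x)).2, hsm, hsm, ← map_sub, ENNReal.ofReal_mul x.coe_nonneg,
          ENNReal.ofReal_coe_nnreal]
    _ = ENNReal.ofReal (φ e) := by
        rw [← ENNReal.ofReal_sum_of_nonneg (fun x _ => mul_nonneg x.coe_nonneg (hnn x)), he,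
          map_sum]
        simp only [map_smul, smul_eq_mul]
    _ ≤ ENNReal.ofReal ‖e‖ := by
        refine ENNReal.ofReal_le_ofReal ((le_abs_self _).trans ?_)
        exact (φ.le_of_opNorm_le hφ e).trans_eq (one_mul _)
    _ ≤ M := ENNReal.ofReal_le_of_le_toReal hnorm

/-- Coordinate evaluations lie in the dual ball, which gives `≥`. For `≤`, the lower integral is a
supremum over simple functions, so `f` need not be measurable. -/
theorem normL1Vec_weightMeasure {V : Set (Lp ℝ 1 μ)} (hV : IsWeightFamily V) (f : Ω → ℝ) :
    normL1Vec (weightMeasure V hV) f = ⨆ v : V, ∫⁻ ω, ‖f ω‖ₑ ∂weighted μ v := by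
  refine le_antisymm (iSup₂_le fun φ hφ => ?_) (iSup_le fun v => ?_)
  · rw [lintegral_eq_nnreal]
    refine iSup₂_le fun g hg => (simpleFunc_lintegral_variation_le hV φ hφ g).trans ?_
    refine iSup_mono fun v => ?_
    rw [← SimpleFunc.lintegral_eq_lintegral]
    exact lintegral_mono hg
  · refine le_trans ?_ (le_iSup₂ (lp.evalCLM ℝ (fun _ : V => ℝ) ∞ v) ?_)
    · rw [scalarMeasure_eval, Measure.variation_toSignedMeasure]
    · refine ContinuousLinearMap.opNorm_le_bound _ zero_le_one fun x => ?_
      rw [one_mul]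
      exact lp.norm_apply_le_norm (by simp) x v

end

/-! ### Separation and Pietsch domination -/

theorem exists_regular_integral_eq {K : Type*} [TopologicalSpace K] [CompactSpace K] [T2Space K]
    [MeasurableSpace K] [BorelSpace K] (L : C(K, ℝ) →ₗ[ℝ] ℝ) (hL : ∀ g, 0 ≤ g → 0 ≤ L g) :
    ∃ η : Measure K, η.Regular ∧ IsFiniteMeasure η ∧ ∀ g : C(K, ℝ), ∫ φ, g φ ∂η = L g := by
  let Λ : CompactlySupportedContinuousMap K ℝ →ₚ[ℝ] ℝ :=
    { toFun := fun g => L g.toContinuousMap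
      map_add' := fun g g' => map_add L g.toContinuousMap g'.toContinuousMap
      map_smul' := fun c g => map_smul L c g.toContinuousMap
      monotone' := fun g g' h => by
        have := hL (g'.toContinuousMap - g.toContinuousMap) fun φ => sub_nonneg.2 (h φ)
        rw [map_sub] at this
        exact sub_nonneg.1 this }
  refine ⟨RealRMK.rieszMeasure Λ, inferInstance, inferInstance, fun g => ?_⟩
  exact RealRMK.integral_rieszMeasure Λ ⟨g, HasCompactSupport.of_compactSpace _⟩

/-- If every function of a convex set `t` of continuous functions on a compact space is
nonnegative at some point, then all of them have nonnegative integral for one and the same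
probability measure. -/
theorem exists_probability_integral_nonneg {K : Type*} [TopologicalSpace K] [CompactSpace K]
    [T2Space K] [MeasurableSpace K] [BorelSpace K] {t : Set C(K, ℝ)} (ht : Convex ℝ t)
    (hne : t.Nonempty) (hpt : ∀ g ∈ t, ∃ φ, 0 ≤ g φ) :
    ∃ η : Measure K, IsProbabilityMeasure η ∧ η.Regular ∧ ∀ g ∈ t, 0 ≤ ∫ φ, g φ ∂η := by
  obtain ⟨b, hb⟩ := hne
  obtain ⟨φ₀, -⟩ := hpt b hb
  have : Nonempty K := ⟨φ₀⟩
  set s : Set C(K, ℝ) := {g | ∀ φ, g φ < 0} with hs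
  have hso : IsOpen s := by
    have := ContinuousMap.isOpen_setOfPred_mapsTo (X := K) (Y := ℝ) isCompact_univ
      (isOpen_Iio (a := (0 : ℝ)))
    convert this using 2
    simp [Set.MapsTo]
  have hsc : Convex ℝ s := by
    intro g hg g' hg' a c ha hc hac φ
    have h1 := hg φ
    have h2 := hg' φ
    simp only [ContinuousMap.add_apply, ContinuousMap.smul_apply, smul_eq_mul]
    rcases ha.eq_or_lt with rfl | ha
    · have : c = 1 := by linarith
      subst this; linarith
    · nlinarith [mul_neg_of_pos_of_neg ha h1, mul_nonneg hc (neg_nonneg.2 h2.le)]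
  have hd : Disjoint s t := by
    refine Set.disjoint_left.2 fun g hg hgt => ?_
    obtain ⟨φ, hφ⟩ := hpt g hgt
    exact absurd (hg φ) hφ.not_gt
  obtain ⟨f, u, hfs, hft⟩ := geometric_hahn_banach_open hsc hso ht hd
  -- `s` is a cone: if `f g > 0`, scaling `g` would push `f` above the bound `u`.
  have hneg : ∀ g ∈ s, f g ≤ 0 := fun g hg => by
    by_contra! h
    have hk : ((|u| + 1) / f g) • g ∈ s := fun φ => by
      simp only [ContinuousMap.smul_apply, smul_eq_mul]
      exact mul_neg_of_pos_of_neg (by positivity) (hg φ)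
    have := hfs _ hk
    rw [map_smul, smul_eq_mul, div_mul_cancel₀ _ h.ne'] at this
    linarith [le_abs_self u]
  have hsmall : ∀ ε : ℝ, 0 < ε → -ε * f 1 < u := fun ε hε => by
    have : (-ε) • (1 : C(K, ℝ)) ∈ s := fun φ => by simpa using hε
    simpa using hfs _ this
  have hone : 0 ≤ f 1 := by
    have : (-1 : C(K, ℝ)) ∈ s := fun φ => by simp
    have := hneg _ this
    rw [map_neg] at this
    linarith
  -- `-g` is only nonpositive, so a small constant is subtracted to land in `s`. The denominator is
  -- `f 1 + 1` because `f 1 = 0` is not yet excluded.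
  have hpos : ∀ g, 0 ≤ g → 0 ≤ f g := fun g hg => by
    refine le_of_forall_pos_le_add fun ε hε => ?_
    have : -g - (ε / (f 1 + 1)) • (1 : C(K, ℝ)) ∈ s := fun φ => by
      have h1 : 0 ≤ g φ := hg φ
      have h2 : 0 < ε / (f 1 + 1) := by positivity
      simp only [ContinuousMap.sub_apply, ContinuousMap.neg_apply, ContinuousMap.smul_apply,
        ContinuousMap.one_apply, smul_eq_mul]
      linarith
    have := hneg _ this
    rw [map_sub, map_neg, map_smul, smul_eq_mul] at this
    have h3 : ε / (f 1 + 1) * f 1 ≤ ε := by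
      rw [div_mul_eq_mul_div, div_le_iff₀ (by positivity)]
      nlinarith
    linarith
  have hu : 0 ≤ u := by
    refine le_of_forall_pos_le_add fun ε hε => ?_
    have := hsmall (ε / (f 1 + 1)) (by positivity)
    have h3 : ε / (f 1 + 1) * f 1 ≤ ε := by
      rw [div_mul_eq_mul_div, div_le_iff₀ (by positivity)]
      nlinarith
    linarith
  -- If `f 1 = 0`, positivity at `‖b‖ - b` gives `f b ≤ 0`, while separation gives `0 = f (-1) < u ≤
  -- f b`.
  have hone' : 0 < f 1 := by
    refine hone.lt_of_ne fun h => ?_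
    have h1 := hpos (‖b‖ • 1 - b) fun φ => by
      simpa using (le_abs_self _).trans (b.norm_coe_le_norm φ)
    rw [map_sub, map_smul, ← h, smul_zero] at h1
    have h2 := hfs (-1) (fun φ => by simp)
    rw [map_neg, ← h] at h2
    linarith [hft b hb]
  obtain ⟨η, hreg, hfin, hη⟩ := exists_regular_integral_eq ((f 1)⁻¹ • (f : C(K, ℝ) →ₗ[ℝ] ℝ))
    fun g hg => mul_nonneg (inv_nonneg.2 hone) (hpos g hg)
  refine ⟨η, ⟨?_⟩, hreg, fun g hg => ?_⟩
  · have := hη 1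
    simp only [ContinuousMap.one_apply, integral_const, smul_eq_mul, mul_one,
      LinearMap.smul_apply, ContinuousLinearMap.coe_coe, inv_mul_cancel₀ hone'.ne'] at this
    rwa [measureReal_def, ENNReal.toReal_eq_one_iff] at this
  · rw [hη]
    exact mul_nonneg (inv_nonneg.2 hone) (hu.trans (hft g hg))

/-- Pietsch domination for a positively `r`-homogeneous function on a normed space. -/
theorem exists_probability_dominating {E : Type*} [NormedAddCommGroup E] [NormedSpace ℝ E]
    {r : ℝ} (hr : 0 < r) (a : E → ℝ) (ha : ∀ (c : ℝ) (x : E), 0 ≤ c → a (c • x) = c ^ r * a x)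
    (h : ∀ (n : ℕ) (x : Fin n → E), ∃ φ : DualBall E,
      ∑ i, a (x i) ≤ ∑ i, |(φ : WeakDual ℝ E) (x i)| ^ r) :
    ∃ η : Measure (DualBall E), IsProbabilityMeasure η ∧ η.Regular ∧
      ∀ x, a x ≤ ∫ φ : DualBall E, |(φ : WeakDual ℝ E) x| ^ r ∂η := by
  let G : E → C(DualBall E, ℝ) := fun x =>
    ⟨fun φ => |evalC E x φ| ^ r - a x,
      (((evalC E x).continuous.abs).rpow_const fun _ => .inr hr.le).sub continuous_const⟩
  have hG : ∀ x (φ : DualBall E), G x φ = |(φ : WeakDual ℝ E) x| ^ r - a x := fun x φ => rfl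
  obtain ⟨η, hη, hreg, hint⟩ := exists_probability_integral_nonneg
    (convex_convexHull ℝ (Set.range G)) ⟨G 0, subset_convexHull _ _ ⟨0, rfl⟩⟩ (fun g hg => by
      obtain ⟨ι, _, w, z, hw, -, hz, rfl⟩ := mem_convexHull_iff_exists_fintype.1 hg
      choose y hy using hz
      let q := Fintype.equivFin ι
      -- By `r`-homogeneity, scaling by `w ^ r⁻¹` absorbs the convex weights into the vectors, so
      -- finite families already cover the convex hull.
      obtain ⟨φ, hφ⟩ := h (Fintype.card ι) fun i => (w (q.symm i)) ^ r⁻¹ • y (q.symm i)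
      refine ⟨φ, ?_⟩
      rw [Equiv.sum_comp q.symm fun i => a (w i ^ r⁻¹ • y i),
        Equiv.sum_comp q.symm fun i => |(φ : WeakDual ℝ E) (w i ^ r⁻¹ • y i)| ^ r,
        ← sub_nonneg, ← Finset.sum_sub_distrib] at hφ
      refine hφ.trans_eq ?_
      rw [ContinuousMap.sum_apply]
      refine Finset.sum_congr rfl fun i _ => ?_
      have hwi : 0 ≤ w i ^ r⁻¹ := Real.rpow_nonneg (hw i) _
      have hwr : (w i ^ r⁻¹) ^ r = w i := Real.rpow_inv_rpow (hw i) hr.ne'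
      rw [ha _ _ hwi, map_smul, smul_eq_mul, abs_mul, abs_of_nonneg hwi,
        Real.mul_rpow hwi (abs_nonneg _), hwr, ← hy i, ContinuousMap.smul_apply, hG, smul_eq_mul,
        mul_sub])
  refine ⟨η, hη, hreg, fun x => ?_⟩
  have hcont : Continuous fun φ : DualBall E => |(φ : WeakDual ℝ E) x| ^ r :=
    ((evalC E x).continuous.abs).rpow_const fun _ => .inr hr.le
  have := hint (G x) (subset_convexHull _ _ ⟨x, rfl⟩)
  simp only [hG] at this
  rw [integral_sub (hcont.integrable_of_hasCompactSupport (HasCompactSupport.of_compactSpace _))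
    (integrable_const _)] at this
  simpa using this

/-! ### Factorization through a range and `L^p` norms -/

theorem LinearMap.exists_factor_range {E F G : Type*} [AddCommGroup E] [Module ℝ E]
    [NormedAddCommGroup F] [NormedSpace ℝ F] [NormedAddCommGroup G] [NormedSpace ℝ G]
    (f : E →ₗ[ℝ] F) (g : E →ₗ[ℝ] G) {C : ℝ} (hC : 0 ≤ C) (h : ∀ x, ‖f x‖ ≤ C * ‖g x‖) :
    ∃ T₀ : LinearMap.range g →L[ℝ] F, ‖T₀‖ ≤ C ∧
      ∀ x, T₀ ⟨g x, LinearMap.mem_range_self g x⟩ = f x := by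
  have key : ∀ x y, g x = g y → f x = f y := fun x y hxy => by
    have := h (x - y)
    rw [map_sub, map_sub, hxy, sub_self, norm_zero, mul_zero] at this
    exact sub_eq_zero.1 (norm_le_zero_iff.1 this)
  -- An arbitrary, possibly nonlinear, section of `g`; by `key` the value of `f ∘ s` does not depend
  -- on it.
  choose s hs using fun y : LinearMap.range g => y.2
  have hfs : ∀ (y : LinearMap.range g) (x : E), (y : G) = g x → f (s y) = f x :=
    fun y x hy => key _ _ ((hs y).trans hy)
  let L : LinearMap.range g →ₗ[ℝ] F :=
    { toFun := fun y => f (s y)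
      map_add' := fun y z => by
        rw [← map_add]
        exact hfs _ _ (by rw [map_add, hs, hs]; rfl)
      map_smul' := fun c y => by
        rw [RingHom.id_apply, ← map_smul]
        exact hfs _ _ (by rw [map_smul, hs]; rfl) }
  refine ⟨L.mkContinuous C fun y => (h _).trans_eq ?_, L.mkContinuous_norm_le hC _,
    fun x => hfs _ _ rfl⟩
  rw [hs]; rfl

/-- A linear map into `L⁰(μ)` with values in `L^p(ν)`, `ν ≪ μ`, as a linear map into `L^p(ν)`. -/
noncomputable def LinearMap.toLpOfMemLp {E Ω : Type*} [AddCommGroup E] [Module ℝ E]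
    [MeasurableSpace Ω] {μ ν : Measure Ω} (hν : ν ≪ μ) {p : ℝ≥0∞} [Fact (1 ≤ p)]
    (T : E →ₗ[ℝ] (Ω →ₘ[μ] ℝ)) (hT : ∀ x, MemLp (T x) p ν) : E →ₗ[ℝ] Lp ℝ p ν where
  toFun x := (hT x).toLp _
  map_add' x y := by
    rw [← MemLp.toLp_add]
    refine (MemLp.toLp_eq_toLp_iff _ _).2 (hν.ae_le ?_)
    rw [map_add]
    exact AEEqFun.coeFn_add _ _
  map_smul' c x := by
    rw [RingHom.id_apply, ← MemLp.toLp_const_smul]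
    refine (MemLp.toLp_eq_toLp_iff _ _).2 (hν.ae_le ?_)
    rw [map_smul]
    exact AEEqFun.coeFn_smul _ _

theorem MeasureTheory.MemLp.toReal_eLpNorm_eq {Ω : Type*} [MeasurableSpace Ω] {ν : Measure Ω}
    {p : ℝ≥0∞} (h0 : p ≠ 0) (hp : p ≠ ∞) {f : Ω → ℝ} (hf : MemLp f p ν) :
    (eLpNorm f p ν).toReal = (∫ ω, |f ω| ^ p.toReal ∂ν) ^ (1 / p.toReal) := by
  rw [hf.eLpNorm_eq_integral_rpow_norm h0 hp, ENNReal.toReal_ofReal (by positivity), one_div]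
  rfl

theorem norm_evalLp {E : Type*} [NormedAddCommGroup E] [NormedSpace ℝ E] {p : ℝ≥0∞}
    [Fact (1 ≤ p)] (hp : p ≠ ∞) (η : Measure (DualBall E)) [IsFiniteMeasure η] (x : E) :
    ‖evalLp E p η x‖ =
      (∫ φ : DualBall E, |(φ : WeakDual ℝ E) x| ^ p.toReal ∂η) ^ (1 / p.toReal) := by
  have h0 : p ≠ 0 := (zero_lt_one.trans_le Fact.out).ne'
  have hae : evalLp E p η x =ᵐ[η] evalC E x := ContinuousMap.coeFn_toLp η (evalC E x)
  have hm : MemLp (evalC E x) p η := (Lp.memLp (evalLp E p η x)).ae_eq hae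
  rw [Lp.norm_def, eLpNorm_congr_ae hae, hm.toReal_eLpNorm_eq h0 hp]
  rfl

theorem rpow_one_div_le_mul_rpow_one_div_iff {r a b C : ℝ} (hr : 0 < r) (ha : 0 ≤ a) (hb : 0 ≤ b)
    (hC : 0 ≤ C) : a ^ (1 / r) ≤ C * b ^ (1 / r) ↔ a ≤ C ^ r * b := by
  rw [one_div, Real.rpow_inv_le_iff_of_pos ha (by positivity) hr,
    Real.mul_rpow hC (by positivity), Real.rpow_inv_rpow hb hr.ne']

/-! ### Integrals against the weights -/

section Weights

variable {Ω : Type*} [MeasurableSpace Ω] {μ : Measure Ω}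

theorem integral_weighted {v : Lp ℝ 1 μ} (hv : 0 ≤ v) (f : Ω → ℝ) :
    ∫ ω, f ω ∂weighted μ v = ∫ ω, f ω * v ω ∂μ := by
  have h0 : 0 ≤ᵐ[μ] (v : Ω → ℝ) := (Lp.coeFn_nonneg v).2 hv
  rw [weighted, integral_withDensity_eq_integral_toReal_smul₀
    (L1.integrable_coeFn v).1.aemeasurable.ennreal_ofReal (by simp)]
  refine integral_congr_ae (h0.mono fun ω hω => ?_)
  simp only
  rw [ENNReal.toReal_ofReal hω, smul_eq_mul, mul_comm]

theorem MeasureTheory.MemLp.integrable_abs_rpow {ν : Measure Ω} {p : ℝ≥0∞} (h0 : p ≠ 0)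
    (hp : p ≠ ∞) {f : Ω → ℝ} (hf : MemLp f p ν) :
    Integrable (fun ω => |f ω| ^ p.toReal) ν :=
  hf.integrable_norm_rpow h0 hp

/-- Decouples the lattice `p`-summing inequality into one scalar inequality per weight: the inner
root cancels, and the supremum over `V` is bounded termwise. -/
theorem normLpVec_weightMeasure_le_iff {p : ℝ≥0∞} (h0 : p ≠ 0) (hp : p ≠ ∞)
    {V : Set (Lp ℝ 1 μ)} (hV : IsWeightFamily V) {n : ℕ} {f : Fin n → Ω → ℝ}
    (hf : ∀ v ∈ V, ∀ i, MemLp (f i) p (weighted μ v)) {B : ℝ} (hB : 0 ≤ B) :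
    normLpVec (weightMeasure V hV) p
        (fun ω => (∑ i, |f i ω| ^ p.toReal) ^ (1 / p.toReal)) ≤ ENNReal.ofReal B ↔
      ∀ v ∈ V, ∑ i, ∫ ω, |f i ω| ^ p.toReal ∂weighted μ v ≤ B ^ p.toReal := by
  have hr : 0 < p.toReal := ENNReal.toReal_pos h0 hp
  have hS : ∀ ω, 0 ≤ ∑ i, |f i ω| ^ p.toReal := fun ω => by positivity
  rw [normLpVec, normL1Vec_weightMeasure, one_div, ENNReal.rpow_inv_le_iff hr, iSup_le_iff,
    ENNReal.ofReal_rpow_of_nonneg hB hr.le, SetCoe.forall]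
  refine forall₂_congr fun v hv => ?_
  have hint : ∀ i, Integrable (fun ω => |f i ω| ^ p.toReal) (weighted μ v) :=
    fun i => (hf v hv i).integrable_abs_rpow h0 hp
  have hpt : ∀ ω, ‖|(∑ i, |f i ω| ^ p.toReal) ^ p.toReal⁻¹| ^ p.toReal‖ₑ =
      ENNReal.ofReal (∑ i, |f i ω| ^ p.toReal) := fun ω => by
    rw [abs_of_nonneg (Real.rpow_nonneg (hS ω) _), Real.rpow_inv_rpow (hS ω) hr.ne',
      Real.enorm_of_nonneg (hS ω)]
  simp only [hpt]
  rw [← ofReal_integral_eq_lintegral_ofReal (integrable_finsetSum _ fun i _ => hint i)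
    (ae_of_all _ hS), integral_finsetSum _ fun i _ => hint i,
    ENNReal.ofReal_le_ofReal_iff (by positivity)]

theorem integral_abs_rpow_map_smul {E : Type*} [AddCommGroup E] [Module ℝ E] {ν : Measure Ω}
    (hν : ν ≪ μ) (T : E →ₗ[ℝ] (Ω →ₘ[μ] ℝ)) (r : ℝ) {c : ℝ} (hc : 0 ≤ c) (x : E) :
    ∫ ω, |T (c • x) ω| ^ r ∂ν = c ^ r * ∫ ω, |T x ω| ^ r ∂ν := by
  rw [← integral_const_mul]
  have hae : T (c • x) =ᵐ[ν] c • (T x : Ω → ℝ) := by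
    rw [map_smul]
    exact hν.ae_le (AEEqFun.coeFn_smul _ _)
  refine integral_congr_ae (hae.mono fun ω hω => ?_)
  simp only
  rw [hω, Pi.smul_apply, smul_eq_mul, abs_mul, abs_of_nonneg hc, Real.mul_rpow hc (abs_nonneg _)]

end Weights

/-! ### Attained suprema over the dual ball -/

section DualBall

variable {E : Type*} [NormedAddCommGroup E] [NormedSpace ℝ E]

instance DualBall.instNonempty : Nonempty (DualBall E) := ⟨⟨0, by simp⟩⟩

theorem continuous_abs_eval_rpow {r : ℝ} (hr : 0 ≤ r) (x : E) :
    Continuous fun φ : DualBall E => |(φ : WeakDual ℝ E) x| ^ r :=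
  (evalC E x).continuous.abs.rpow_const fun _ => .inr hr

/-- Weak-star compactness. The maximizer supplies the point `φ` that `exists_probability_dominating`
asks for. -/
theorem exists_isGreatest_dualBall_sum {r : ℝ} (hr : 0 < r) {n : ℕ} (x : Fin n → E) :
    ∃ φ₀ : DualBall E, IsGreatest (Set.range fun φ : DualBall E =>
        (∑ i, |(φ : WeakDual ℝ E) (x i)| ^ r) ^ (1 / r))
      ((∑ i, |(φ₀ : WeakDual ℝ E) (x i)| ^ r) ^ (1 / r)) := by
  have hcont : Continuous fun φ : DualBall E =>
      (∑ i, |(φ : WeakDual ℝ E) (x i)| ^ r) ^ (1 / r) :=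
    (continuous_finsetSum _ fun i _ => continuous_abs_eval_rpow hr.le (x i)).rpow_const
      fun _ => .inr (by positivity)
  obtain ⟨φ₀, -, hφ₀⟩ := isCompact_univ.exists_isMaxOn Set.univ_nonempty hcont.continuousOn
  exact ⟨φ₀, ⟨φ₀, rfl⟩, by rintro _ ⟨φ, rfl⟩; exact hφ₀ (Set.mem_univ φ)⟩

end DualBall

/-! ### The equivalences -/

section Conditions

variable {Ω₁ Ω₂ : Type*} [MeasurableSpace Ω₁] [MeasurableSpace Ω₂]
  {μ₁ : Measure Ω₁} {μ₂ : Measure Ω₂} {p : ℝ≥0∞} [Fact (1 ≤ p)]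
  {X : BanachFunctionSpace μ₁} {V : Set (Lp ℝ 1 μ₂)} {T : X.carrier →ₗ[ℝ] (Ω₂ →ₘ[μ₂] ℝ)}

theorem isAverageDominated_iff_factorsUniformly (hp : p ≠ ∞) (hV : ∀ v ∈ V, 0 ≤ v)
    (hT : ∀ v ∈ V, ∀ x, MemLp (T x) p (weighted μ₂ v)) :
    IsAverageDominated X V p T ↔ FactorsUniformly X V p T := by
  have h0 : p ≠ 0 := (zero_lt_one.trans_le Fact.out).ne'
  have hnorm : ∀ v ∈ V, ∀ x, (eLpNorm (T x) p (weighted μ₂ v)).toReal =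
      (∫ ω, |T x ω| ^ p.toReal * (v : Ω₂ → ℝ) ω ∂μ₂) ^ (1 / p.toReal) := fun v hv x => by
    rw [(hT v hv x).toReal_eLpNorm_eq h0 hp, integral_weighted (hV v hv)]
  constructor
  · rintro ⟨C, hC, h⟩
    refine ⟨C, fun v hv => ?_⟩
    obtain ⟨η, hη, hreg, hle⟩ := h v hv
    obtain ⟨T₀, hT₀, heq⟩ := LinearMap.exists_factor_range
      (T.toLpOfMemLp (weighted_absolutelyContinuous v) (hT v hv)) (evalLp X.carrier p η) hC.le
      fun x => by
        rw [norm_evalLp hp]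
        exact (Lp.norm_toLp _ (hT v hv x)).trans_le ((hnorm v hv x).trans_le (hle x))
    refine ⟨η, hη, hreg, T₀, hT₀, fun x => ?_⟩
    rw [heq]
    exact MemLp.coeFn_toLp (hT v hv x)
  · rintro ⟨C, h⟩
    -- The constant in (iii) is not required to be positive, the one in (ii) is.
    refine ⟨max C 1, by positivity, fun v hv => ?_⟩
    obtain ⟨η, hη, hreg, T₀, hT₀, heq⟩ := h v hv
    refine ⟨η, hη, hreg, fun x => ?_⟩
    rw [← hnorm v hv x, ← eLpNorm_congr_ae (heq x), ← Lp.norm_def, ← norm_evalLp hp]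
    exact T₀.le_of_opNorm_le (hT₀.trans (le_max_left _ _)) _

theorem isLatticeSumming_iff_isAverageDominated (hp : p ≠ ∞) (hV : IsWeightFamily V)
    (hT : ∀ v ∈ V, ∀ x, MemLp (T x) p (weighted μ₂ v))
    (hTm : ∀ x, MemLpVec (weightMeasure V hV) p (T x)) :
    IsLatticeSumming (weightMeasure V hV) p T ↔ IsAverageDominated X V p T := by
  have h0 : p ≠ 0 := (zero_lt_one.trans_le Fact.out).ne'
  have hr : 0 < p.toReal := ENNReal.toReal_pos h0 hp
  rw [IsLatticeSumming, and_iff_right hTm]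
  refine exists_congr fun C => and_congr_right fun hC => ?_
  have hI : ∀ v ∈ V, ∀ x, 0 ≤ ∫ ω, |T x ω| ^ p.toReal ∂weighted μ₂ v := fun v _ x =>
    integral_nonneg fun ω => by positivity
  constructor
  · intro h v hv
    obtain ⟨η, hη, hreg, hle⟩ := exists_probability_dominating hr
      -- Dividing by `C ^ p` normalizes the domination constant to `1`.
      (fun x => (C ^ p.toReal)⁻¹ * ∫ ω, |T x ω| ^ p.toReal ∂weighted μ₂ v)
      (fun c x hc => by
        rw [integral_abs_rpow_map_smul (weighted_absolutelyContinuous v) T _ hc, mul_left_comm])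
      fun n x => by
        obtain ⟨φ, hφ⟩ := exists_isGreatest_dualBall_sum hr x
        refine ⟨φ, ?_⟩
        have hn := h n x
        rw [iSup, hφ.csSup_eq, normLpVec_weightMeasure_le_iff h0 hp hV
          (fun v hv i => hT v hv (x i)) (by positivity)] at hn
        have hn := hn v hv
        rw [Real.mul_rpow hC.le (by positivity), one_div,
          Real.rpow_inv_rpow (by positivity) hr.ne'] at hn
        rw [← Finset.mul_sum, inv_mul_le_iff₀ (by positivity)]
        exact hn
    refine ⟨η, hη, hreg, fun x => ?_⟩
    have hx := hle x
    rw [inv_mul_le_iff₀ (by positivity)] at hx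
    rw [← integral_weighted (hV.nonneg v hv), rpow_one_div_le_mul_rpow_one_div_iff hr (hI v hv x)
      (integral_nonneg fun φ => by positivity) hC.le]
    exact hx
  · intro h n x
    obtain ⟨φ₀, hφ₀⟩ := exists_isGreatest_dualBall_sum hr x
    rw [iSup, hφ₀.csSup_eq, normLpVec_weightMeasure_le_iff h0 hp hV
      (fun v hv i => hT v hv (x i)) (by positivity), Real.mul_rpow hC.le (by positivity), one_div,
      Real.rpow_inv_rpow (by positivity) hr.ne']
    intro v hv
    obtain ⟨η, hη, -, hle⟩ := h v hv
    have hint : ∀ i, Integrable (fun φ : DualBall X.carrier =>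
        |(φ : WeakDual ℝ X.carrier) (x i)| ^ p.toReal) η := fun i =>
      (continuous_abs_eval_rpow hr.le (x i)).integrable_of_hasCompactSupport
        (HasCompactSupport.of_compactSpace _)
    calc ∑ i, ∫ ω, |T (x i) ω| ^ p.toReal ∂weighted μ₂ v
        ≤ ∑ i, C ^ p.toReal * ∫ φ : DualBall X.carrier,
            |(φ : WeakDual ℝ X.carrier) (x i)| ^ p.toReal ∂η := by
          refine Finset.sum_le_sum fun i _ => ?_
          have := hle (x i)
          rwa [← integral_weighted (hV.nonneg v hv),
            rpow_one_div_le_mul_rpow_one_div_iff hr (hI v hv (x i))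
              (integral_nonneg fun φ => by positivity) hC.le] at this
      _ = C ^ p.toReal * ∫ φ : DualBall X.carrier,
            ∑ i, |(φ : WeakDual ℝ X.carrier) (x i)| ^ p.toReal ∂η := by
          rw [← Finset.mul_sum, integral_finsetSum _ fun i _ => hint i]
      _ ≤ C ^ p.toReal * ∫ _ : DualBall X.carrier,
            ∑ i, |(φ₀ : WeakDual ℝ X.carrier) (x i)| ^ p.toReal ∂η := by
          refine mul_le_mul_of_nonneg_left (integral_mono
            (integrable_finsetSum _ fun i _ => hint i) (integrable_const _) fun φ => ?_)
            (by positivity)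
          -- `φ₀` maximizes the `1/p`-th power of the sum, hence the sum itself; the resulting
          -- constant integrates to itself because `η` is a probability measure.
          have := hφ₀.2 ⟨φ, rfl⟩
          rwa [Real.rpow_le_rpow_iff (by positivity) (by positivity) (by positivity)] at this
      _ = _ := by simp

end Conditions

theorem mainTheorem11 {Ω₁ Ω₂ : Type*} [MeasurableSpace Ω₁] [MeasurableSpace Ω₂]
    (μ₁ : Measure Ω₁) (μ₂ : Measure Ω₂) [IsFiniteMeasure μ₁] [IsFiniteMeasure μ₂]
    (p : ℝ≥0∞) [Fact (1 ≤ p)] (hp : p ≠ ∞)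
    (X : BanachFunctionSpace μ₁)
    (V : Set (Lp ℝ 1 μ₂)) (hV : IsWeightFamily V)
    (T : X.carrier →ₗ[ℝ] (Ω₂ →ₘ[μ₂] ℝ))
    (hT : ∀ v ∈ V, ∀ x, MemLp (T x) p (weighted μ₂ v)) :
    (IsAverageDominated X V p T ↔ FactorsUniformly X V p T) ∧
    ((∀ x, MemLpVec (weightMeasure V hV) p (T x)) →
      [IsLatticeSumming (weightMeasure V hV) p T,
        IsAverageDominated X V p T,
        FactorsUniformly X V p T].TFAE) := by
  have h := isAverageDominated_iff_factorsUniformly hp hV.nonneg hT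
  refine ⟨h, fun hTm => ?_⟩
  tfae_have 1 ↔ 2 := isLatticeSumming_iff_isAverageDominated hp hV hT hTm
  tfae_have 2 ↔ 3 := h
  tfae_finish
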